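/- **Theorem 4.1 (Nullstellensatz).** Let $n,q\ge 0$ be integers and let $\mathcal D=\mathbb C[D_1,\dots,D_n]$ with $D_j=\frac1{\imath}\frac{\partial}{\partial x_j}$, acting on the smooth functions $\mathbb R^n\to\mathbb C$. Let $\mathcal C^\infty(\mathrm{protorus})$ be the algebra of smooth functions $f:\mathbb R^n\to\mathbb C$ that are periodic with respect to the lattice $2\pi N\mathbb Z^n$ for some integer $N\ge 1$ depending on $f$, let $\mathcal C^\infty(\mathrm{protorus})_{\mathrm{fin}}$ be the subalgebra of those $f$ whose Fourier series $f(x)=\sum_{a\in\mathbb Q^n}c_a e^{\imath\langle a,x\rangle}$ is a finite sum, and let $\mathcal F=\mathcal C^\infty(\mathrm{protorus})_{\mathrm{fin}}[x_1,\dots,x_n]$ be the algebra of functions on $\mathbb R^n$ obtained by adjoining the coordinate functions; $\mathcal F$ is a $\mathcal D$-module. For a submodule $\mathcal M\subset\mathcal D^q$ put $$\mathcal M^{\perp}=\Big\{f\in\mathcal F^q : \sum_j r_j(f_j)=0 \text{ for all } r\in\mathcal M\Big\},\qquad \mathcal M^{\perp\perp}=\Big\{r\in\mathcal D^q : \sum_j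 r_j(f_j)=0 \text{ for all } f\in\mathcal M^\perp\Big\};$$ $\mathcal M^{\perp\perp}$ is the Willems closure of $\mathcal M$ with respect to $\mathcal F$. Let $\mathcal M=\mathcal M_1\cap\dots\cap\mathcal M_t$ be an irredundant primary decomposition, i.e. each $\mathcal M_i\subset\mathcal D^q$ is a submodule such that $\mathcal D^q/\mathcal M_i$ has exactly one associated prime $\mathfrak p_i$, and no $\mathcal M_i$ can be omitted from the intersection (the empty intersection being $\mathcal D^q$). Let $\mathcal V(\mathfrak p_i)\subset\mathbb C^n$ be the set of common zeros of the polynomials in $\mathfrak p_i$, where $D_1,\dots,D_n$ are the coordinates; a rational point of it is a point of $\mathcal V(\mathfrak p_i)\cap\mathbb Q^n$. Then $$\mathcal M^{\perp\perp}=\bigcap_{i\,:\,\mathcal V(\mathfrak p_i)\cap\mathbb Q^n\neq\emptyset}\mathcal M_i .$$ In particular, $\mathcal M=\mathcal M^{\perp\perp}$ if and only if every $\mathcal V(\mathfrak p_i)$, $i=1,\dots,t$, contains a rational point. -/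

import Mathlib

open scoped ContDiff

noncomputable section

/-! ### Constant coefficient differential operators acting on smooth functions -/

/-- The algebra `C^∞(ℝⁿ)` of smooth complex valued functions on `ℝⁿ`. -/
def SmoothFunctions (n : ℕ) : Subalgebra ℂ ((Fin n → ℝ) → ℂ) where
  carrier := {f | ContDiff ℝ ∞ f}
  mul_mem' {f g} hf hg := by
    rw [Set.mem_ofPred_eq] at hf hg ⊢
    exact hf.mul hg
  add_mem' {f g} hf hg := by
    rw [Set.mem_ofPred_eq] at hf hg ⊢
    exact hf.add hg
  algebraMap_mem' c := (contDiff_const : ContDiff ℝ ∞ fun _ : Fin n → ℝ => c)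

theorem contDiff_smooth {n : ℕ} (f : SmoothFunctions n) :
    ContDiff ℝ ∞ (f : (Fin n → ℝ) → ℂ) := f.2

theorem differentiable_smooth {n : ℕ} (f : SmoothFunctions n) :
    Differentiable ℝ (f : (Fin n → ℝ) → ℂ) :=
  (contDiff_smooth f).differentiable (by simp)

/-- The operator `D_j = (1/i) ∂/∂x_j` on `C^∞(ℝⁿ)`. -/
def diffOp (n : ℕ) (j : Fin n) : Module.End ℂ (SmoothFunctions n) where
  toFun f := ⟨fun x => (1 / Complex.I) * fderiv ℝ (f : (Fin n → ℝ) → ℂ) x (Pi.single j 1), by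
    have h : ContDiff ℝ ∞ (fderiv ℝ (f : (Fin n → ℝ) → ℂ)) := (contDiff_smooth f).fderiv_right (by simp)
    change ContDiff ℝ ∞ _
    exact contDiff_const.mul (h.clm_apply contDiff_const)⟩
  map_add' f g := by
    ext x
    have h := fderiv_add (differentiable_smooth f x) (differentiable_smooth g x)
    simp [h, mul_add]
  map_smul' c f := by
    ext x
    have h := fderiv_const_smul (differentiable_smooth f x) c
    simp [h]
    ring

theorem diffOp_apply {n : ℕ} (j : Fin n) (f : SmoothFunctions n) (x : Fin n → ℝ) :
    (diffOp n j f : (Fin n → ℝ) → ℂ) x =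
      (1 / Complex.I) * fderiv ℝ (f : (Fin n → ℝ) → ℂ) x (Pi.single j 1) := rfl

theorem diffOp_comm (n : ℕ) (j k : Fin n) : diffOp n j * diffOp n k = diffOp n k * diffOp n j := by
  have key : ∀ (j k : Fin n) (f : SmoothFunctions n) (x : Fin n → ℝ),
      (diffOp n j (diffOp n k f) : (Fin n → ℝ) → ℂ) x = (1 / Complex.I) * ((1 / Complex.I) *
        fderiv ℝ (fderiv ℝ (f : (Fin n → ℝ) → ℂ)) x (Pi.single j 1) (Pi.single k 1)) := by
    intro j k f x
    have h : ContDiff ℝ ∞ (fderiv ℝ (f : (Fin n → ℝ) → ℂ)) := (contDiff_smooth f).fderiv_right (by simp)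
    have hd : DifferentiableAt ℝ (fderiv ℝ (f : (Fin n → ℝ) → ℂ)) x :=
      (h.differentiable (by simp)) x
    have hd' : DifferentiableAt ℝ
        (fun y => fderiv ℝ (f : (Fin n → ℝ) → ℂ) y (Pi.single k 1)) x :=
      hd.clm_apply (differentiableAt_const _)
    have e : (diffOp n k f : (Fin n → ℝ) → ℂ) = fun y => (1 / Complex.I) *
        fderiv ℝ (f : (Fin n → ℝ) → ℂ) y (Pi.single k 1) := rfl
    rw [diffOp_apply, e, fderiv_const_mul hd', fderiv_clm_apply hd (differentiableAt_const _)]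
    simp
  ext f x
  have hs : IsSymmSndFDerivAt ℝ (f : (Fin n → ℝ) → ℂ) x :=
    ContDiffAt.isSymmSndFDerivAt (n := ∞) (contDiff_smooth f).contDiffAt
      (by simpa using (WithTop.coe_le_coe.2 le_top : ((2 : ℕ∞) : WithTop ℕ∞) ≤ ∞))
  change (diffOp n j (diffOp n k f) : (Fin n → ℝ) → ℂ) x =
    (diffOp n k (diffOp n j f) : (Fin n → ℝ) → ℂ) x
  rw [key, key, hs]

/-- The ring `𝒟 = ℂ[D_1, …, D_n]`: the variable `X j` stands for `D_j = (1/i) ∂/∂x_j`. -/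
abbrev DiffRing (n : ℕ) : Type := MvPolynomial (Fin n) ℂ

open scoped IsMulCommutative in
/-- The action `L ↦ L(D)` of `𝒟` on `C^∞(ℝⁿ)`: the algebra homomorphism into the linear
endomorphisms that sends the variable `X j` to the operator `D_j` (see `diffHom_X`). -/
def diffHom (n : ℕ) : DiffRing n →ₐ[ℂ] Module.End ℂ (SmoothFunctions n) :=
  haveI : IsMulCommutative (Algebra.adjoin ℂ (Set.range (diffOp n))) :=
    Algebra.isMulCommutative_adjoin ℂ (by
      rintro _ ⟨j, rfl⟩ _ ⟨k, rfl⟩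
      exact diffOp_comm n j k)
  (Algebra.adjoin ℂ (Set.range (diffOp n))).val.comp
    (MvPolynomial.aeval fun j => ⟨diffOp n j, Algebra.subset_adjoin ⟨j, rfl⟩⟩)

theorem diffHom_X (n : ℕ) (j : Fin n) : diffHom n (MvPolynomial.X j) = diffOp n j := by
  simp [diffHom]

/-- `C^∞(ℝⁿ)` as a `𝒟`-module. -/
instance SmoothFunctions.instModule (n : ℕ) : Module (DiffRing n) (SmoothFunctions n) :=
  Module.compHom (SmoothFunctions n) (diffHom n).toRingHom

theorem diffRing_smul_def {n : ℕ} (L : DiffRing n) (f : SmoothFunctions n) :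
    L • f = diffHom n L f := rfl

theorem diffRing_X_smul {n : ℕ} (j : Fin n) (f : SmoothFunctions n) :
    (MvPolynomial.X j : DiffRing n) • f = diffOp n j f := by
  rw [diffRing_smul_def, diffHom_X]

theorem diffRing_C_smul {n : ℕ} (c : ℂ) (f : SmoothFunctions n) :
    (MvPolynomial.C c : DiffRing n) • f = c • f := by
  rw [diffRing_smul_def, ← MvPolynomial.algebraMap_eq, AlgHom.commutes,
    Module.algebraMap_end_apply]

/-! ### Periodic functions and the signal space -/

/-- The algebra `C^∞(protorus)`: the smooth functions on `ℝⁿ` that are periodic with respect to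
the lattice `2πN ℤⁿ` for some integer `N ≥ 1` depending on the function. -/
def ProtorusSmooth (n : ℕ) : Subalgebra ℂ (SmoothFunctions n) where
  carrier := {f | ∃ N : ℕ, 1 ≤ N ∧ ∀ (k : Fin n → ℤ) (x : Fin n → ℝ),
    (f : (Fin n → ℝ) → ℂ) (x + fun j => 2 * Real.pi * N * k j) = (f : (Fin n → ℝ) → ℂ) x}
  mul_mem' := by
    rintro f g ⟨N, hN, hf⟩ ⟨P, hP, hg⟩
    refine ⟨N * P, Nat.mul_pos hN hP, fun k x => ?_⟩
    have h1 := hf (fun j => P * k j) x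
    have h2 := hg (fun j => N * k j) x
    have e1 : (fun j => 2 * Real.pi * ((N * P : ℕ) : ℝ) * (k j : ℝ)) =
        fun j => 2 * Real.pi * N * (((P : ℤ) * k j : ℤ) : ℝ) := by
      ext j; push_cast; ring
    have e2 : (fun j => 2 * Real.pi * ((N * P : ℕ) : ℝ) * (k j : ℝ)) =
        fun j => 2 * Real.pi * P * (((N : ℤ) * k j : ℤ) : ℝ) := by
      ext j; push_cast; ring
    rw [← e1] at h1
    rw [← e2] at h2
    change f.1 _ * g.1 _ = f.1 x * g.1 x
    rw [h1, h2]
  add_mem' := by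
    rintro f g ⟨N, hN, hf⟩ ⟨P, hP, hg⟩
    refine ⟨N * P, Nat.mul_pos hN hP, fun k x => ?_⟩
    have h1 := hf (fun j => P * k j) x
    have h2 := hg (fun j => N * k j) x
    have e1 : (fun j => 2 * Real.pi * ((N * P : ℕ) : ℝ) * (k j : ℝ)) =
        fun j => 2 * Real.pi * N * (((P : ℤ) * k j : ℤ) : ℝ) := by
      ext j; push_cast; ring
    have e2 : (fun j => 2 * Real.pi * ((N * P : ℕ) : ℝ) * (k j : ℝ)) =
        fun j => 2 * Real.pi * P * (((N : ℤ) * k j : ℤ) : ℝ) := by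
      ext j; push_cast; ring
    rw [← e1] at h1
    rw [← e2] at h2
    change f.1 _ + g.1 _ = f.1 x + g.1 x
    rw [h1, h2]
  algebraMap_mem' c := ⟨1, le_rfl, fun _ _ => rfl⟩

/-- The function `x ↦ e^{i⟨a,x⟩}` for `a ∈ ℚⁿ`. -/
def expFun (n : ℕ) (a : Fin n → ℚ) : SmoothFunctions n :=
  ⟨fun x => Complex.exp (Complex.I * ∑ j, (a j : ℂ) * (x j : ℂ)), by
    change ContDiff ℝ ∞ _
    refine ContDiff.cexp (contDiff_const.mul (ContDiff.sum fun j _ => contDiff_const.mul ?_))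
    exact Complex.ofRealCLM.contDiff.comp (contDiff_apply ℝ ℝ j)⟩

theorem expFun_apply {n : ℕ} (a : Fin n → ℚ) (x : Fin n → ℝ) :
    (expFun n a : (Fin n → ℝ) → ℂ) x =
      Complex.exp (Complex.I * ∑ j, (a j : ℂ) * (x j : ℂ)) := rfl

theorem expFun_zero (n : ℕ) : expFun n 0 = 1 := by
  ext x
  simp [expFun_apply]

theorem expFun_mul (n : ℕ) (a b : Fin n → ℚ) : expFun n a * expFun n b = expFun n (a + b) := by
  ext x
  simp only [MulMemClass.coe_mul, Pi.mul_apply, expFun_apply, ← Complex.exp_add]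
  congr 1
  rw [← mul_add, ← Finset.sum_add_distrib]
  simp [add_mul]

/-- The algebra `C^∞(protorus)_fin`: the elements of `C^∞(protorus)` whose Fourier series
`∑_{a ∈ ℚⁿ} c_a e^{i⟨a,x⟩}` is a finite sum. -/
def ProtorusFin (n : ℕ) : Subalgebra ℂ (SmoothFunctions n) where
  carrier := {f | f ∈ ProtorusSmooth n ∧ f ∈ Submodule.span ℂ (Set.range (expFun n))}
  mul_mem' := by
    rintro f g ⟨hf, hf'⟩ ⟨hg, hg'⟩
    refine ⟨mul_mem hf hg, ?_⟩
    have h := Submodule.mul_mem_mul hf' hg'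
    rw [Submodule.span_mul_span] at h
    refine Submodule.span_mono ?_ h
    rintro _ ⟨_, ⟨a, rfl⟩, _, ⟨b, rfl⟩, rfl⟩
    exact ⟨a + b, (expFun_mul n a b).symm⟩
  add_mem' := by
    rintro f g ⟨hf, hf'⟩ ⟨hg, hg'⟩
    exact ⟨add_mem hf hg, add_mem hf' hg'⟩
  algebraMap_mem' c := by
    refine ⟨algebraMap_mem _ c, ?_⟩
    rw [Algebra.algebraMap_eq_smul_one, ← expFun_zero]
    exact Submodule.smul_mem _ _ (Submodule.subset_span ⟨0, rfl⟩)

/-- The coordinate function `x_j` on `ℝⁿ`. -/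
def coordFun (n : ℕ) (j : Fin n) : SmoothFunctions n :=
  ⟨fun x => (x j : ℂ), by
    change ContDiff ℝ ∞ _
    exact Complex.ofRealCLM.contDiff.comp (contDiff_apply ℝ ℝ j)⟩

/-- The algebra `C^∞(protorus)_fin[x_1, …, x_n]` obtained inside `C^∞(ℝⁿ)` by adjoining the
coordinate functions to `C^∞(protorus)_fin`. -/
def signalAlgebra (n : ℕ) : Subalgebra (ProtorusFin n) (SmoothFunctions n) :=
  Algebra.adjoin (ProtorusFin n) (Set.range (coordFun n))

theorem diffOp_mul {n : ℕ} (j : Fin n) (f g : SmoothFunctions n) :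
    diffOp n j (f * g) = diffOp n j f * g + f * diffOp n j g := by
  ext x
  have h := fderiv_mul (differentiable_smooth f x) (differentiable_smooth g x)
  simp only [diffOp_apply, MulMemClass.coe_mul, AddMemClass.coe_add, Pi.mul_apply, Pi.add_apply, h]
  simp
  ring

theorem diffOp_expFun {n : ℕ} (j : Fin n) (a : Fin n → ℚ) :
    diffOp n j (expFun n a) = (a j : ℂ) • expFun n a := by
  ext x
  have hp : ∀ k : Fin n, HasFDerivAt (fun y : Fin n → ℝ => (y k : ℂ))
      (Complex.ofRealCLM.comp (ContinuousLinearMap.proj (R := ℝ) (φ := fun _ => ℝ) k)) x :=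
    fun k => (Complex.ofRealCLM.comp
      (ContinuousLinearMap.proj (R := ℝ) (φ := fun _ => ℝ) k)).hasFDerivAt
  have h := ((HasFDerivAt.fun_sum (u := Finset.univ)
    fun k _ => (hp k).const_mul (a k : ℂ)).const_mul Complex.I).cexp
  have e : (expFun n a : (Fin n → ℝ) → ℂ) =
    fun y => Complex.exp (Complex.I * ∑ k, (a k : ℂ) * (y k : ℂ)) := rfl
  rw [diffOp_apply, e, h.fderiv]
  simp [expFun_apply, Pi.single_apply, apply_ite]
  field_simp
  simp

theorem diffOp_coordFun {n : ℕ} (j k : Fin n) :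
    diffOp n j (coordFun n k) = algebraMap ℂ _ (if k = j then 1 / Complex.I else 0) := by
  ext x
  have hp : HasFDerivAt (coordFun n k : (Fin n → ℝ) → ℂ)
      (Complex.ofRealCLM.comp (ContinuousLinearMap.proj (R := ℝ) (φ := fun _ => ℝ) k)) x :=
    (Complex.ofRealCLM.comp
      (ContinuousLinearMap.proj (R := ℝ) (φ := fun _ => ℝ) k)).hasFDerivAt
  rw [diffOp_apply, hp.fderiv]
  change _ = (if k = j then 1 / Complex.I else 0)
  simp [Pi.single_apply, apply_ite]

theorem diffOp_mem_protorusSmooth {n : ℕ} (j : Fin n) {f : SmoothFunctions n}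
    (hf : f ∈ ProtorusSmooth n) : diffOp n j f ∈ ProtorusSmooth n := by
  obtain ⟨N, hN, h⟩ := hf
  refine ⟨N, hN, fun k x => ?_⟩
  rw [diffOp_apply, diffOp_apply, ← fderiv_comp_add_right]
  simp only [h]

theorem diffOp_mem_protorusFin {n : ℕ} (j : Fin n) {f : SmoothFunctions n}
    (hf : f ∈ ProtorusFin n) : diffOp n j f ∈ ProtorusFin n := by
  refine ⟨diffOp_mem_protorusSmooth j hf.1, ?_⟩
  have h : Submodule.span ℂ (Set.range (expFun n)) ≤
      (Submodule.span ℂ (Set.range (expFun n))).comap (diffOp n j) := by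
    rw [Submodule.span_le]
    rintro _ ⟨a, rfl⟩
    change diffOp n j (expFun n a) ∈ Submodule.span ℂ (Set.range (expFun n))
    rw [diffOp_expFun]
    exact Submodule.smul_mem _ _ (Submodule.subset_span ⟨a, rfl⟩)
  exact h hf.2

theorem diffOp_mem_signalAlgebra {n : ℕ} (j : Fin n) {f : SmoothFunctions n}
    (hf : f ∈ signalAlgebra n) : diffOp n j f ∈ signalAlgebra n := by
  have hfin : ∀ g ∈ ProtorusFin n, g ∈ signalAlgebra n := fun g hg =>
    algebraMap_mem (signalAlgebra n) (⟨g, hg⟩ : ProtorusFin n)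
  induction hf using Algebra.adjoin_induction with
  | mem x hx =>
    obtain ⟨k, rfl⟩ := hx
    rw [diffOp_coordFun]
    exact hfin _ (algebraMap_mem _ _)
  | algebraMap r => exact hfin _ (diffOp_mem_protorusFin j r.2)
  | add x y _ _ hx hy => rw [map_add]; exact add_mem hx hy
  | mul x y hx' hy' hx hy =>
    rw [diffOp_mul]
    exact add_mem (mul_mem hx hy') (mul_mem hx' hy)

/-- The signal space `ℱ = C^∞(protorus)_fin[x_1, …, x_n]` as a `𝒟`-submodule of `C^∞(ℝⁿ)`. -/
def signalSpace (n : ℕ) : Submodule (DiffRing n) (SmoothFunctions n) where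
  carrier := {f | f ∈ signalAlgebra n}
  zero_mem' := zero_mem (signalAlgebra n)
  add_mem' {f g} hf hg := by
    rw [Set.mem_ofPred_eq] at hf hg ⊢
    exact add_mem hf hg
  smul_mem' L f hf := by
    change L • f ∈ signalAlgebra n
    induction L using MvPolynomial.induction_on generalizing f with
    | C c =>
      rw [diffRing_C_smul, Algebra.smul_def]
      have hc : algebraMap ℂ (SmoothFunctions n) c ∈ signalAlgebra n :=
        algebraMap_mem (signalAlgebra n) (algebraMap ℂ (ProtorusFin n) c)
      exact mul_mem hc hf
    | add p q hp hq => rw [add_smul]; exact add_mem (hp f hf) (hq f hf)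
    | mul_X p j hp =>
      rw [mul_smul, diffRing_X_smul]
      exact hp _ (diffOp_mem_signalAlgebra j hf)

/-! ### Behaviors and the Willems closure -/

section Behaviors

variable {R : Type*} [CommRing R] {F : Type*} [AddCommGroup F] [Module R F] {q : ℕ}

/-- The behavior `M^⊥ ⊆ F^q` of a submodule `M ⊆ R^q`. -/
def behavior (F : Type*) [AddCommGroup F] [Module R F] (M : Submodule R (Fin q → R)) :
    Submodule R (Fin q → F) where
  carrier := {f | ∀ r ∈ M, ∑ j, r j • f j = 0}
  zero_mem' r _ := by simp
  add_mem' hf hg r hr := by simp [smul_add, Finset.sum_add_distrib, hf r hr, hg r hr]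
  smul_mem' c f hf r hr := by simp [smul_comm _ c, ← Finset.smul_sum, hf r hr]

/-- The submodule `B^⊥ ⊆ R^q` of a submodule `B ⊆ F^q`. -/
def equations (B : Submodule R (Fin q → F)) : Submodule R (Fin q → R) where
  carrier := {r | ∀ f ∈ B, ∑ j, r j • f j = 0}
  zero_mem' f _ := by simp
  add_mem' hr hs f hf := by simp [add_smul, Finset.sum_add_distrib, hr f hf, hs f hf]
  smul_mem' c r hr f hf := by simp [mul_smul, ← Finset.smul_sum, hr f hf]

/-- The Willems closure `M^⊥⊥ ⊆ R^q` of `M ⊆ R^q` with respect to the signal space `F`. -/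
def willemsClosure (F : Type*) [AddCommGroup F] [Module R F] (M : Submodule R (Fin q → R)) :
    Submodule R (Fin q → R) :=
  equations (behavior F M)

end Behaviors

/-! ### Primary decompositions and rational points -/

/-- `N ⊆ E` is `p`-primary if `p` is the only associated prime of `E / N`. -/
def IsPrimaryTo {R E : Type*} [CommRing R] [AddCommGroup E] [Module R E]
    (N : Submodule R E) (p : Ideal R) : Prop :=
  associatedPrimes R (E ⧸ N) = {p}

/-- `M = N_1 ∩ ⋯ ∩ N_t` is an irredundant primary decomposition with `N_i` being
`p_i`-primary; irredundant means that no term can be omitted. -/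
structure IsIrredundantPrimaryDecomposition {R E : Type*} [CommRing R] [AddCommGroup E]
    [Module R E] {t : ℕ} (M : Submodule R E) (N : Fin t → Submodule R E)
    (p : Fin t → Ideal R) : Prop where
  eq_iInf : M = ⨅ i, N i
  primary : ∀ i, IsPrimaryTo (N i) (p i)
  irredundant : ∀ i, M ≠ ⨅ (j : Fin t) (_ : j ≠ i), N j

/-- The variety `V(p) ⊆ 𝔸ⁿ(ℂ)` contains a point with rational coordinates. -/
def HasRationalPoint {n : ℕ} (p : Ideal (DiffRing n)) : Prop :=
  ∃ b : Fin n → ℚ, (fun j => (b j : ℂ)) ∈ MvPolynomial.zeroLocus ℂ p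

end

/-! ### Exponentials and coordinate functions -/

/-! Signals are combinations of polynomials times exponentials `e^{i⟨a,x⟩}` with `a` rational. Hence
each signal is killed by a finite product of maximal ideals `m_a` of rational points
(`mem_pointTorsion_of_mem_signalSpace`). Conversely, every functional on `𝒟` vanishing on a power of
`m_b` is `L ↦ (L f)(0)` for a signal `f` (`mem_representable_of_pointIdeal_pow`).

If `V(p_i)` has a rational point `b` and `r ∉ N_i`, Krull's intersection theorem gives `k` with `r ∉
N_i + m_b^k 𝒟^q`. A functional separating `r` from this sum comes from a tuple of signals, which
satisfies the equations of `N_i` but not `r`.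

If `r` lies in all `N_i` with rational points and `f ∈ M^⊥`, then `g = ∑ r_j f_j` is killed by a
product of ideals `m_a`. By prime avoidance, a polynomial outside these `m_a` multiplies `r` into
`M`, so it kills `g` as well; comaximality forces `g = 0`. -/

/-- The maximal ideal of a rational point. -/
noncomputable def pointIdeal {n : ℕ} (a : Fin n → ℚ) : Ideal (DiffRing n) :=
  RingHom.ker (MvPolynomial.aeval (R := ℂ) (S₁ := ℂ) fun j => (a j : ℂ))

theorem mem_pointIdeal {n : ℕ} {a : Fin n → ℚ} {L : DiffRing n} :
    L ∈ pointIdeal a ↔ MvPolynomial.aeval (fun j => (a j : ℂ)) L = (0 : ℂ) := Iff.rfl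

theorem pointIdeal_isMaximal {n : ℕ} (a : Fin n → ℚ) : (pointIdeal a).IsMaximal :=
  RingHom.ker_isMaximal_of_surjective _ fun c =>
    ⟨MvPolynomial.C c, by simp⟩

theorem hasRationalPoint_iff {n : ℕ} {p : Ideal (DiffRing n)} :
    HasRationalPoint p ↔ ∃ b, p ≤ pointIdeal b := Iff.rfl

theorem diffRing_smul_comm {n : ℕ} (c : ℂ) (L : DiffRing n) (f : SmoothFunctions n) :
    L • c • f = c • L • f := by
  rw [← diffRing_C_smul, ← diffRing_C_smul, smul_comm]

theorem diffRing_smul_expFun {n : ℕ} (a : Fin n → ℚ) (L : DiffRing n) :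
    L • expFun n a = (MvPolynomial.aeval (fun j => (a j : ℂ)) L : ℂ) • expFun n a := by
  induction L using MvPolynomial.induction_on with
  | C c => simp [diffRing_C_smul]
  | add p q hp hq => rw [add_smul, hp, hq, map_add, add_smul]
  | mul_X p j hp =>
    rw [mul_smul, diffRing_X_smul, diffOp_expFun, diffRing_smul_comm, hp, smul_smul, map_mul,
      MvPolynomial.aeval_X, mul_comm]

/-- The commutator of `L(D)` with multiplication by `x_j` differentiates the symbol `L`, up to the
factor `1/i`. All later uses of coordinate functions go through this formula. -/
theorem diffRing_smul_coordFun_mul {n : ℕ} (j : Fin n) (L : DiffRing n) (f : SmoothFunctions n) :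
    L • (coordFun n j * f) =
      coordFun n j * L • f + (1 / Complex.I) • MvPolynomial.pderiv j L • f := by
  induction L using MvPolynomial.induction_on generalizing f with
  | C c => simp [diffRing_C_smul]
  | add p q hp hq => simp only [add_smul, hp, hq, map_add, mul_add, smul_add]; abel
  | mul_X p k hp =>
    rw [mul_smul, diffRing_X_smul, diffOp_mul, diffOp_coordFun, smul_add, hp, mul_smul,
      diffRing_X_smul, Derivation.leibniz, MvPolynomial.pderiv_X, add_smul, smul_add,
      smul_eq_mul, smul_eq_mul, mul_comm (MvPolynomial.X k), mul_smul, mul_smul,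
      diffRing_X_smul, ← Algebra.smul_def, diffRing_smul_comm]
    by_cases h : j = k
    · subst h
      simp only [if_true, Pi.single_eq_same, one_smul]
      abel
    · simp [h, Ne.symm h]

theorem expFun_mem_protorusFin {n : ℕ} (a : Fin n → ℚ) : expFun n a ∈ ProtorusFin n := by
  -- The product of the denominators clears all frequencies at once, so it gives a common period.
  refine ⟨⟨∏ j, (a j).den, Finset.prod_pos fun j _ => (a j).den_pos, fun k x => ?_⟩,
    Submodule.subset_span ⟨a, rfl⟩⟩
  have h : ∀ j, ∃ m : ℤ, (a j : ℂ) * ((∏ i, (a i).den : ℕ) : ℂ) = m := by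
    intro j
    obtain ⟨d, hd⟩ := Finset.dvd_prod_of_mem (fun i => (a i).den) (Finset.mem_univ j)
    refine ⟨(a j).num * d, ?_⟩
    rw [hd]
    have h0 : (((a j).den : ℕ) : ℂ) ≠ 0 := Nat.cast_ne_zero.2 (a j).den_nz
    rw [Rat.cast_def]
    push_cast
    field_simp
  choose m hm using h
  rw [expFun_apply, expFun_apply, Complex.exp_eq_exp_iff_exists_int]
  refine ⟨∑ j, m j * k j, ?_⟩
  push_cast
  rw [Finset.sum_mul, Finset.mul_sum, Finset.mul_sum, ← Finset.sum_add_distrib]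
  refine Finset.sum_congr rfl fun j _ => ?_
  rw [← hm j]
  simp only [Pi.add_apply]
  push_cast
  ring

theorem expFun_mem_signalSpace {n : ℕ} (a : Fin n → ℚ) : expFun n a ∈ signalSpace n :=
  algebraMap_mem (signalAlgebra n) (⟨expFun n a, expFun_mem_protorusFin a⟩ : ProtorusFin n)

theorem coordFun_mul_mem_signalSpace {n : ℕ} (j : Fin n) {f : SmoothFunctions n}
    (hf : f ∈ signalSpace n) : coordFun n j * f ∈ signalSpace n :=
  mul_mem (S := Subalgebra (ProtorusFin n) (SmoothFunctions n)) (s := signalAlgebra n)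
    (Algebra.subset_adjoin ⟨j, rfl⟩) hf

/-! ### Signals are annihilated by products of point ideals -/

theorem pderiv_mem_of_mem_mul_self {n : ℕ} (j : Fin n) {J : Ideal (DiffRing n)} {L : DiffRing n}
    (hL : L ∈ J * J) : MvPolynomial.pderiv j L ∈ J := by
  induction hL using Submodule.mul_induction_on' with
  | mem_mul_mem a ha b hb =>
    rw [Derivation.leibniz]
    exact add_mem (J.mul_mem_right _ ha) (J.mul_mem_right _ hb)
  | add x _ y _ hx hy => rw [map_add]; exact add_mem hx hy

/-- The smooth functions annihilated by a finite product of ideals of rational points. -/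
noncomputable def pointTorsion (n : ℕ) : Submodule ℂ (SmoothFunctions n) where
  carrier := {f | ∃ s : Multiset (Fin n → ℚ), ∀ L ∈ (s.map pointIdeal).prod, L • f = 0}
  zero_mem' := by
    rw [Set.mem_ofPred_eq]
    exact ⟨0, fun L _ => smul_zero L⟩
  add_mem' {f g} hf hg := by
    rw [Set.mem_ofPred_eq] at hf hg ⊢
    obtain ⟨s, hs⟩ := hf
    obtain ⟨t, ht⟩ := hg
    refine ⟨s + t, fun L hL => ?_⟩
    rw [Multiset.map_add, Multiset.prod_add] at hL
    rw [smul_add, hs L (Ideal.mul_le_left hL), ht L (Ideal.mul_le_right hL), add_zero]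
  smul_mem' c f hf := by
    rw [Set.mem_ofPred_eq] at hf ⊢
    obtain ⟨s, hs⟩ := hf
    exact ⟨s, fun L hL => by rw [diffRing_smul_comm, hs L hL, smul_zero]⟩

theorem expFun_mem_pointTorsion {n : ℕ} (a : Fin n → ℚ) : expFun n a ∈ pointTorsion n := by
  refine ⟨{a}, fun L hL => ?_⟩
  rw [Multiset.map_singleton, Multiset.prod_singleton, mem_pointIdeal] at hL
  rw [diffRing_smul_expFun, hL, zero_smul]

/-- If `J` kills `f`, then `J * J` kills `x_j f`: the commutator term involves `∂_j L`, which is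
still in `J` for `L ∈ J * J`. Hence the doubled multiset `s + s`. -/
theorem coordFun_mul_mem_pointTorsion {n : ℕ} (j : Fin n) {f : SmoothFunctions n}
    (hf : f ∈ pointTorsion n) : coordFun n j * f ∈ pointTorsion n := by
  obtain ⟨s, hs⟩ := hf
  refine ⟨s + s, fun L hL => ?_⟩
  rw [Multiset.map_add, Multiset.prod_add] at hL
  rw [diffRing_smul_coordFun_mul, hs L (Ideal.mul_le_right hL),
    hs _ (pderiv_mem_of_mem_mul_self j hL), mul_zero, smul_zero, add_zero]

theorem mem_pointTorsion_of_mem_signalSpace {n : ℕ} {f : SmoothFunctions n}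
    (hf : f ∈ signalSpace n) : f ∈ pointTorsion n := by
  have hf' : f ∈ Subalgebra.toSubmodule (signalAlgebra n) := hf
  rw [signalAlgebra, Algebra.adjoin_eq_span] at hf'
  have key : ∀ m ∈ Submonoid.closure (Set.range (coordFun n)), ∀ c : ProtorusFin n,
      c • m ∈ pointTorsion n := by
    intro m hm
    induction hm using Submonoid.closure_induction_left with
    | one =>
      intro c
      have hc : (c : SmoothFunctions n) ∈ pointTorsion n :=
        Submodule.span_le.2 (by rintro _ ⟨a, rfl⟩; exact expFun_mem_pointTorsion a) c.2.2
      rwa [Algebra.smul_def, mul_one]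
    | mul_left x hx y hy ih =>
      obtain ⟨j, rfl⟩ := hx
      intro c
      rw [← mul_smul_comm]
      exact coordFun_mul_mem_pointTorsion j (ih c)
  -- `pointTorsion` is only a `ℂ`-submodule; quantifying over `c` absorbs the `ProtorusFin` scalars
  -- of the span.
  suffices h : ∀ c : ProtorusFin n, c • f ∈ pointTorsion n by simpa using h 1
  clear hf
  induction hf' using Submodule.span_induction with
  | mem x hx => exact key x hx
  | zero => intro c; rw [smul_zero]; exact zero_mem _
  | add x y _ _ hx hy => intro c; rw [smul_add]; exact add_mem (hx c) (hy c)
  | smul a x _ hx => intro c; rw [smul_smul]; exact hx _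

/-! ### Signals are determined by the values of their derivatives at the origin -/

theorem eq_const_of_diffOp_eq_zero {n : ℕ} {g : SmoothFunctions n}
    (hg : ∀ j, diffOp n j g = 0) (x : Fin n → ℝ) : g.1 x = g.1 0 := by
  refine is_const_of_fderiv_eq_zero (𝕜 := ℝ) (differentiable_smooth g) (fun y => ?_) x 0
  apply ContinuousLinearMap.coe_injective
  refine LinearMap.pi_ext' fun j => LinearMap.ext_ring ?_
  have h : (diffOp n j g).1 y = 0 := by rw [hg j]; rfl
  rw [diffOp_apply] at h
  simpa using h

/-- Multiplying `h` by `e^{-i⟨a,x⟩}` makes every first derivative vanish, so `h` is a constant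
multiple of `expFun n a`. -/
theorem eq_zero_of_pointIdeal_smul_eq_zero {n : ℕ} {a : Fin n → ℚ} {h : SmoothFunctions n}
    (ha : ∀ L ∈ pointIdeal a, L • h = 0) (h0 : h.1 0 = 0) : h = 0 := by
  have hD : ∀ j, diffOp n j h = (a j : ℂ) • h := by
    intro j
    have := ha (MvPolynomial.X j - MvPolynomial.C (a j : ℂ)) (by simp [mem_pointIdeal])
    rwa [sub_smul, diffRing_X_smul, diffRing_C_smul, sub_eq_zero] at this
  have hg : ∀ j, diffOp n j (expFun n (-a) * h) = 0 := by
    intro j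
    rw [diffOp_mul, diffOp_expFun, hD, smul_mul_assoc, mul_smul_comm, ← add_smul]
    simp
  ext x
  have hx := eq_const_of_diffOp_eq_zero hg x
  change (expFun n (-a)).1 x * h.1 x = (expFun n (-a)).1 0 * h.1 0 at hx
  rw [h0, mul_zero] at hx
  exact (mul_eq_zero.1 hx).resolve_left (Complex.exp_ne_zero _)

/-- Peel off one factor `m_a` at a time: for `L` in the remaining product, `L • g` is killed by
`m_a` and vanishes at the origin, hence is zero. -/
theorem eq_zero_of_forall_smul_apply_zero {n : ℕ} {g : SmoothFunctions n}
    (hg : g ∈ pointTorsion n) (h0 : ∀ L : DiffRing n, (L • g).1 0 = 0) : g = 0 := by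
  obtain ⟨s, hs⟩ := hg
  induction s using Multiset.induction_on with
  | empty => simpa using hs 1 (by simp)
  | cons a s ih =>
    refine ih fun L hL => eq_zero_of_pointIdeal_smul_eq_zero (a := a) (fun K hK => ?_) (h0 L)
    rw [← mul_smul]
    refine hs _ ?_
    rw [Multiset.map_cons, Multiset.prod_cons]
    exact Ideal.mul_mem_mul hK hL

/-! ### Functionals represented by signals -/

/-- The functionals `L ↦ (L f)(0)` on `𝒟` given by the signals `f`. -/
noncomputable def representable (n : ℕ) : Submodule ℂ (Module.Dual ℂ (DiffRing n)) where
  carrier := {φ | ∃ f ∈ signalSpace n, ∀ L : DiffRing n, φ L = (L • f).1 0}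
  zero_mem' := ⟨0, zero_mem _, fun L => by rw [smul_zero]; rfl⟩
  add_mem' := by
    rintro φ ψ ⟨f, hf, hφ⟩ ⟨g, hg, hψ⟩
    refine ⟨f + g, add_mem hf hg, fun L => ?_⟩
    rw [LinearMap.add_apply, hφ, hψ, smul_add]
    rfl
  smul_mem' := by
    rintro c φ ⟨f, hf, hφ⟩
    refine ⟨c • f, ?_, fun L => ?_⟩
    · rw [← diffRing_C_smul]
      exact Submodule.smul_mem _ _ hf
    · rw [diffRing_smul_comm, LinearMap.smul_apply, hφ]
      rfl

/-- At the origin the term `x_j * (L f)` of the commutator formula vanishes, so `x_j f` represents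
`φ ∘ ∂_j` up to the factor `1/i`. -/
theorem comp_pderiv_mem_representable {n : ℕ} {φ : Module.Dual ℂ (DiffRing n)}
    (hφ : φ ∈ representable n) (j : Fin n) :
    φ ∘ₗ (MvPolynomial.pderiv j : Derivation ℂ (DiffRing n) (DiffRing n)).toLinearMap ∈
      representable n := by
  obtain ⟨f, hf, hφ⟩ := hφ
  have h : (1 / Complex.I)⁻¹ • (coordFun n j * f) ∈ signalSpace n := by
    rw [← diffRing_C_smul]
    exact Submodule.smul_mem _ _ (coordFun_mul_mem_signalSpace j hf)
  refine ⟨_, h, fun L => ?_⟩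
  rw [diffRing_smul_comm, diffRing_smul_coordFun_mul, LinearMap.comp_apply, hφ]
  change (MvPolynomial.pderiv j L • f).1 0 = (1 / Complex.I)⁻¹ * (((0 : ℝ) : ℂ) * (L • f).1 0 +
    (1 / Complex.I) * (MvPolynomial.pderiv j L • f).1 0)
  simp [← mul_assoc]

/-- The substitution `X_j ↦ X_j + b_j`. -/
noncomputable def translatePoly {n : ℕ} (b : Fin n → ℂ) : DiffRing n →ₐ[ℂ] DiffRing n :=
  MvPolynomial.aeval fun j => MvPolynomial.X j + MvPolynomial.C (b j)

theorem translatePoly_X {n : ℕ} (b : Fin n → ℂ) (j : Fin n) :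
    translatePoly b (MvPolynomial.X j) = MvPolynomial.X j + MvPolynomial.C (b j) :=
  MvPolynomial.aeval_X _ _

theorem translatePoly_C {n : ℕ} (b : Fin n → ℂ) (c : ℂ) :
    translatePoly b (MvPolynomial.C c) = MvPolynomial.C c :=
  MvPolynomial.algHom_C _ _

theorem translatePoly_neg_translatePoly {n : ℕ} (b : Fin n → ℂ) (L : DiffRing n) :
    translatePoly (-b) (translatePoly b L) = L := by
  induction L using MvPolynomial.induction_on with
  | C c => simp only [translatePoly_C]
  | add p q hp hq => rw [map_add, map_add, hp, hq]
  | mul_X p j hp =>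
    rw [map_mul, map_mul, hp, translatePoly_X, map_add, translatePoly_X, translatePoly_C]
    simp

theorem pderiv_translatePoly {n : ℕ} (b : Fin n → ℂ) (j : Fin n) (L : DiffRing n) :
    MvPolynomial.pderiv j (translatePoly b L) = translatePoly b (MvPolynomial.pderiv j L) := by
  induction L using MvPolynomial.induction_on with
  | C c => simp
  | add p q hp hq => simp only [map_add, hp, hq]
  | mul_X p k hp =>
    simp only [map_mul, translatePoly_X, Derivation.leibniz, map_add, MvPolynomial.pderiv_C, hp,
      MvPolynomial.pderiv_X, smul_eq_mul, add_zero]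
    by_cases h : j = k
    · subst h; simp
    · simp [Ne.symm h]

theorem constantCoeff_translatePoly {n : ℕ} (b : Fin n → ℂ) (L : DiffRing n) :
    MvPolynomial.coeff 0 (translatePoly b L) = MvPolynomial.aeval b L := by
  change MvPolynomial.constantCoeff (translatePoly b L) = _
  induction L using MvPolynomial.induction_on with
  | C c => simp
  | add p q hp hq => simp only [map_add, hp, hq]
  | mul_X p k hp => rw [map_mul, map_mul, hp]; simp [translatePoly_X]

/-- These functionals are the Taylor coefficients at `b`: evaluation at `b` is represented by
`expFun n b`, and the others follow by composing with partial derivatives and rescaling. -/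
theorem coeff_translatePoly_mem_representable {n : ℕ} (b : Fin n → ℚ) (m : Fin n →₀ ℕ) :
    MvPolynomial.lcoeff ℂ m ∘ₗ (translatePoly fun j => (b j : ℂ)).toLinearMap ∈
      representable n := by
  induction hk : m.degree generalizing m with
  | zero =>
    rw [Finsupp.degree_eq_zero_iff] at hk
    subst hk
    refine ⟨expFun n b, expFun_mem_signalSpace b, fun L => ?_⟩
    rw [diffRing_smul_expFun]
    change MvPolynomial.coeff 0 (translatePoly _ L) = _ * (expFun n b).1 0
    rw [constantCoeff_translatePoly, expFun_apply]
    simp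
  | succ k ih =>
    have hm : m ≠ 0 := by rintro rfl; simp at hk
    obtain ⟨j, hj⟩ := Finsupp.ne_iff.1 hm
    obtain ⟨m', rfl⟩ : ∃ m', m = m' + Finsupp.single j 1 :=
      ⟨m - Finsupp.single j 1, (tsub_add_cancel_of_le (by
        rw [Finsupp.single_le_iff]; exact Nat.one_le_iff_ne_zero.2 hj)).symm⟩
    have hk' : m'.degree = k := by simpa using hk
    have h := Submodule.smul_mem _ ((m' j + 1 : ℂ)⁻¹)
      (comp_pderiv_mem_representable (ih m' hk') j)
    convert h using 1
    refine LinearMap.ext fun L => ?_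
    have h0 : (m' j + 1 : ℂ) ≠ 0 := by exact_mod_cast Nat.succ_ne_zero (m' j)
    change MvPolynomial.coeff (m' + Finsupp.single j 1) (translatePoly _ L) = (m' j + 1 : ℂ)⁻¹ *
      MvPolynomial.coeff m' (translatePoly _ (MvPolynomial.pderiv j L))
    rw [← pderiv_translatePoly, MvPolynomial.coeff_pderiv]
    field_simp

theorem translatePoly_neg_mem_pointIdeal_pow {n : ℕ} (b : Fin n → ℚ) (k : ℕ) (j : Fin n)
    {m : Fin n →₀ ℕ} (hm : k ≤ m j) :
    translatePoly (-fun j => (b j : ℂ)) (MvPolynomial.monomial m 1) ∈ pointIdeal b ^ k := by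
  have hX : translatePoly (-fun j => (b j : ℂ)) (MvPolynomial.X j) ∈ pointIdeal b := by
    rw [translatePoly_X, mem_pointIdeal]
    simp
  have hd : (MvPolynomial.X j ^ k : DiffRing n) ∣ MvPolynomial.monomial m 1 := by
    rw [MvPolynomial.X_pow_eq_monomial, MvPolynomial.monomial_dvd_monomial]
    exact ⟨Or.inr (Finsupp.single_le_iff.2 hm), dvd_rfl⟩
  obtain ⟨K, hK⟩ := hd
  rw [hK, map_mul, map_pow]
  exact Ideal.mul_mem_right _ _ (Ideal.pow_mem_pow hX k)

/-- Such a `φ` is a finite combination of Taylor coefficients at `b`. -/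
theorem mem_representable_of_pointIdeal_pow {n : ℕ} (b : Fin n → ℚ) (k : ℕ)
    {φ : Module.Dual ℂ (DiffRing n)} (hφ : ∀ L ∈ pointIdeal b ^ k, φ L = 0) :
    φ ∈ representable n := by
  let b' : Fin n → ℂ := fun j => (b j : ℂ)
  -- A box suffices: a monomial outside it has some exponent above `k`, so its translate lies in
  -- `m_b^k`.
  let S : Finset (Fin n →₀ ℕ) := Finset.Iic (Finsupp.equivFunOnFinite.symm fun _ => k)
  have h : φ ∘ₗ (translatePoly (-b')).toLinearMap =
      ∑ m ∈ S, φ (translatePoly (-b') (MvPolynomial.monomial m 1)) • MvPolynomial.lcoeff ℂ m := by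
    refine MvPolynomial.linearMap_ext fun m => LinearMap.ext_ring ?_
    simp only [LinearMap.comp_apply, AlgHom.toLinearMap_apply, LinearMap.sum_apply,
      LinearMap.smul_apply, MvPolynomial.lcoeff_apply, MvPolynomial.coeff_monomial, smul_eq_mul,
      mul_ite, mul_one, mul_zero, Finset.sum_ite_eq]
    split_ifs with hm
    · rfl
    · rw [Finset.mem_Iic, Finsupp.le_def, not_forall] at hm
      obtain ⟨j, hj⟩ := hm
      exact hφ _ (translatePoly_neg_mem_pointIdeal_pow b k j (not_le.1 hj).le)
  have h' : φ = ∑ m ∈ S, φ (translatePoly (-b') (MvPolynomial.monomial m 1)) •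
      (MvPolynomial.lcoeff ℂ m ∘ₗ (translatePoly b').toLinearMap) := by
    refine LinearMap.ext fun L => ?_
    have := LinearMap.congr_fun h (translatePoly b' L)
    rw [LinearMap.comp_apply, AlgHom.toLinearMap_apply, translatePoly_neg_translatePoly] at this
    rw [this]
    simp
  rw [h']
  exact Submodule.sum_mem _ fun m _ =>
    Submodule.smul_mem _ _ (coeff_translatePoly_mem_representable b m)

/-! ### Primary submodules -/

section Primary

variable {R E : Type*} [CommRing R] [IsNoetherianRing R] [AddCommGroup E] [Module R E]

/-- Minimal primes of the annihilator of `E ⧸ N` are associated, hence equal to `p`, so `p` lies in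
the radical of the annihilator. -/
theorem IsPrimaryTo.exists_pow_smul_mem [Module.Finite R E] {N : Submodule R E} {p : Ideal R}
    (hN : IsPrimaryTo N p) {s : R} (hs : s ∈ p) : ∃ l : ℕ, ∀ x : E, s ^ l • x ∈ N := by
  have h : s ∈ (Module.annihilator R (E ⧸ N)).radical := by
    rw [← Ideal.sInf_minimalPrimes, Ideal.mem_sInf]
    intro P hP
    have := Module.associatedPrimes.minimalPrimes_annihilator_subset_associatedPrimes R _ hP
    rw [hN, Set.mem_singleton_iff] at this
    rwa [this]
  obtain ⟨l, hl⟩ := h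
  refine ⟨l, fun x => ?_⟩
  have := Module.mem_annihilator.1 hl (Submodule.Quotient.mk x)
  rwa [← Submodule.Quotient.mk_smul, Submodule.Quotient.mk_eq_zero] at this

/-- By Krull, an element of every `m ^ k • (E ⧸ N)` is fixed by some `a ∈ m`. If it is nonzero, `1 -
a` is a zero divisor on `E ⧸ N`, so it lies in `p ≤ m`, and `1 ∈ m`. -/
theorem IsPrimaryTo.exists_notMem_sup_pow_smul [Module.Finite R E] {N : Submodule R E}
    {p m : Ideal R} (hN : IsPrimaryTo N p) (hm : m ≠ ⊤) (hp : p ≤ m) {x : E} (hx : x ∉ N) :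
    ∃ k : ℕ, x ∉ N ⊔ m ^ k • (⊤ : Submodule R E) := by
  by_contra! hc
  have hx' : N.mkQ x ∈ (⨅ k : ℕ, m ^ k • ⊤ : Submodule R (E ⧸ N)) := by
    rw [Submodule.mem_iInf]
    intro k
    have := Submodule.mem_map_of_mem (f := N.mkQ) (hc k)
    rw [Submodule.map_sup, Submodule.map_smul''] at this
    simpa using this
  rw [Ideal.mem_iInf_smul_pow_eq_bot_iff] at hx'
  obtain ⟨a, ha⟩ := hx'
  have h1 : (1 - (a : R)) ∈ {r : R | ∃ y : E ⧸ N, y ≠ 0 ∧ r • y = 0} := by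
    refine ⟨N.mkQ x, fun h0 => hx (by simpa using h0), ?_⟩
    rw [sub_smul, one_smul, ha, sub_self]
  rw [← biUnion_associatedPrimes_eq_zero_divisors, hN] at h1
  simp only [Set.mem_singleton_iff, Set.iUnion_iUnion_eq_left, SetLike.mem_coe] at h1
  exact hm ((Ideal.eq_top_iff_one m).2 (by simpa using add_mem (hp h1) a.2))

end Primary

/-! ### Willems closure -/

section Closure

variable {R : Type*} [CommRing R] {F : Type*} [AddCommGroup F] [Module R F] {q : ℕ}

theorem willemsClosure_mono {M N : Submodule R (Fin q → R)} (h : M ≤ N) :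
    willemsClosure F M ≤ willemsClosure F N :=
  fun _ hr f hf => hr f fun s hs => hf s (h hs)

end Closure

/-- A shortcut instance for the action of `𝒟` on signals. -/
noncomputable instance signalSpace.instSMul (n : ℕ) : SMul (DiffRing n) (signalSpace n) :=
  (signalSpace n).module.toSMul

theorem willemsClosure_le_of_isPrimaryTo {n q : ℕ}
    {N : Submodule (DiffRing n) (Fin q → DiffRing n)} {p : Ideal (DiffRing n)}
    (hN : IsPrimaryTo N p) (hp : HasRationalPoint p) :
    willemsClosure (signalSpace n) N ≤ N := by
  obtain ⟨b, hb⟩ := hasRationalPoint_iff.1 hp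
  intro r hr
  by_contra hrN
  obtain ⟨k, hk⟩ := hN.exists_notMem_sup_pow_smul (pointIdeal_isMaximal b).ne_top hb hrN
  set W := N ⊔ pointIdeal b ^ k • (⊤ : Submodule (DiffRing n) (Fin q → DiffRing n)) with hW
  obtain ⟨φ, hφr, hφ⟩ := Submodule.exists_le_ker_of_notMem (p := W.restrictScalars ℂ) hk
  have hφW : ∀ s ∈ W, φ s = 0 := fun s hs => hφ hs
  have hrep : ∀ j, φ ∘ₗ LinearMap.single ℂ (fun _ => DiffRing n) j ∈ representable n := by
    refine fun j => mem_representable_of_pointIdeal_pow b k fun L hL => hφW _ ?_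
    have : (Pi.single j L : Fin q → DiffRing n) = L • Pi.single j 1 := by
      rw [← Pi.single_smul]; simp
    change Pi.single j L ∈ W
    rw [this]
    exact Submodule.mem_sup_right (Submodule.smul_mem_smul hL trivial)
  choose f hf hfφ using hrep
  have key : ∀ s : Fin q → DiffRing n, φ s = (∑ j, s j • f j).1 0 := by
    intro s
    have h1 : φ s = ∑ j, φ (Pi.single j (s j)) := by
      rw [← map_sum, Finset.univ_sum_single]
    have h2 : ∀ j, φ (Pi.single j (s j)) = (s j • f j).1 0 := fun j => hfφ j (s j)
    rw [h1, Finset.sum_congr rfl fun j _ => h2 j]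
    let ev : SmoothFunctions n →+ ℂ :=
      { toFun := fun g => g.1 0, map_zero' := rfl, map_add' := fun _ _ => rfl }
    exact (map_sum ev _ _).symm
  let F : Fin q → signalSpace n := fun j => ⟨f j, hf j⟩
  have hcoe : ∀ s : Fin q → DiffRing n,
      ((∑ j, s j • F j : signalSpace n) : SmoothFunctions n) = ∑ j, s j • f j := by
    intro s
    rw [Submodule.coe_sum]
    rfl
  have hF : F ∈ behavior (signalSpace n) N := by
    intro s hs
    apply Subtype.ext
    -- `φ` kills `L • s` for every `L`, since `N` is a `𝒟`-submodule; so all derivatives of the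
    -- signal vanish at the origin.
    refine eq_zero_of_forall_smul_apply_zero
      (mem_pointTorsion_of_mem_signalSpace (Subtype.property _)) fun L => ?_
    have : (L • ∑ j, s j • f j) = ∑ j, (L • s) j • f j := by
      rw [Finset.smul_sum]
      exact Finset.sum_congr rfl fun j _ => (mul_smul L (s j) (f j)).symm
    rw [hcoe, this, ← key]
    exact hφW _ (Submodule.mem_sup_left (N.smul_mem L hs))
  have h0 := congrArg (fun g : signalSpace n => (g : SmoothFunctions n).1 0) (hr F hF)
  simp only [hcoe, ← key] at h0
  exact hφr h0

theorem exists_mem_notMem_pointIdeal {n : ℕ} {p : Ideal (DiffRing n)}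
    (hp : ¬ HasRationalPoint p) (A : Finset (Fin n → ℚ)) : ∃ s ∈ p, ∀ a ∈ A, s ∉ pointIdeal a := by
  by_contra! hc
  have h : (p : Set (DiffRing n)) ⊆ ⋃ a ∈ (A : Set (Fin n → ℚ)), pointIdeal a := by
    intro s hs
    obtain ⟨a, ha, hsa⟩ := hc s hs
    exact Set.mem_biUnion ha hsa
  -- Prime avoidance allows two non-prime exceptions; none occur here, so both slots get the dummy
  -- point `0`.
  rw [Ideal.subset_union_prime 0 0 fun a _ _ _ => (pointIdeal_isMaximal a).isPrime] at h
  obtain ⟨a, _, ha⟩ := h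
  exact hp (hasRationalPoint_iff.2 ⟨a, ha⟩)

/-- A maximal ideal containing the product equals some `m_a`, which omits `S`. So the product and
`S` generate the unit ideal, and both kill `g`. -/
theorem eq_zero_of_notMem_pointIdeal_of_smul_eq_zero {n : ℕ} {s : Multiset (Fin n → ℚ)}
    {S : DiffRing n} {g : SmoothFunctions n} (hS : ∀ a ∈ s, S ∉ pointIdeal a)
    (hg : ∀ L ∈ (s.map pointIdeal).prod, L • g = 0) (hSg : S • g = 0) : g = 0 := by
  have htop : (s.map pointIdeal).prod ⊔ Ideal.span {S} = ⊤ := by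
    by_contra hne
    obtain ⟨P, hP, hle⟩ := Ideal.exists_le_maximal _ hne
    obtain ⟨a, ha, haP⟩ := (hP.isPrime.multiset_prod_map_le _).1 (le_sup_left.trans hle)
    rw [← (pointIdeal_isMaximal a).eq_of_le hP.ne_top haP] at hle
    exact hS a ha (hle (Ideal.mem_sup_right (Ideal.mem_span_singleton_self S)))
  obtain ⟨L, hL, K, hK, h1⟩ := Submodule.mem_sup.1 ((Ideal.eq_top_iff_one _).1 htop)
  obtain ⟨K', rfl⟩ := Ideal.mem_span_singleton'.1 hK
  rw [← one_smul (DiffRing n) g, ← h1, add_smul, hg L hL, mul_smul, hSg, smul_zero, add_zero]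

set_option synthInstance.maxHeartbeats 200000 in
theorem iInf_hasRationalPoint_le_willemsClosure {n q t : ℕ}
    {N : Fin t → Submodule (DiffRing n) (Fin q → DiffRing n)} {p : Fin t → Ideal (DiffRing n)}
    (hN : ∀ i, IsPrimaryTo (N i) (p i)) :
    (⨅ (i : Fin t) (_ : HasRationalPoint (p i)), N i) ≤
      willemsClosure (signalSpace n) (⨅ i, N i) := by
  intro r hr f hf
  have hr' : ∀ i, HasRationalPoint (p i) → r ∈ N i := by
    simpa only [Submodule.mem_iInf] using hr
  set g : signalSpace n := ∑ j, r j • f j with hg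
  obtain ⟨s, hs⟩ := mem_pointTorsion_of_mem_signalSpace g.2
  -- Each component gets its own multiplier: `1` when `r` is already in `N i`, otherwise a power of
  -- an element of `p i` found by prime avoidance.
  have hex : ∀ i, ∃ S : DiffRing n, S • r ∈ N i ∧ ∀ a ∈ s.toFinset, S ∉ pointIdeal a := by
    intro i
    by_cases hi : HasRationalPoint (p i)
    · refine ⟨1, by simpa using hr' i hi, fun a _ => ?_⟩
      exact (Ideal.ne_top_iff_one _).1 (pointIdeal_isMaximal a).ne_top
    · obtain ⟨S, hSp, hSa⟩ := exists_mem_notMem_pointIdeal hi s.toFinset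
      obtain ⟨l, hl⟩ := (hN i).exists_pow_smul_mem hSp
      exact ⟨S ^ l, hl r, fun a ha h =>
        hSa a ha ((pointIdeal_isMaximal a).isPrime.mem_of_pow_mem l h)⟩
  choose S hSr hSa using hex
  have hmem : (∏ i, S i) • r ∈ ⨅ i, N i := by
    rw [Submodule.mem_iInf]
    intro i
    obtain ⟨K, hK⟩ := Finset.dvd_prod_of_mem S (Finset.mem_univ i)
    rw [hK, mul_comm, mul_smul]
    exact (N i).smul_mem K (hSr i)
  have hSg : (∏ i, S i) • g = 0 := by
    rw [hg, Finset.smul_sum, ← hf _ hmem]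
    exact Finset.sum_congr rfl fun j _ => (mul_smul _ (r j) (f j)).symm
  apply Subtype.ext
  refine eq_zero_of_notMem_pointIdeal_of_smul_eq_zero (S := ∏ i, S i) (fun a ha h => ?_) hs
    (congrArg Subtype.val hSg)
  obtain ⟨i, _, hi⟩ := ((pointIdeal_isMaximal a).isPrime.prod_mem_iff).1 h
  exact hSa i a (Multiset.mem_toFinset.2 ha) hi

theorem theorem4p1 (n q t : ℕ) (M : Submodule (DiffRing n) (Fin q → DiffRing n))
    (N : Fin t → Submodule (DiffRing n) (Fin q → DiffRing n)) (p : Fin t → Ideal (DiffRing n))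
    (hM : IsIrredundantPrimaryDecomposition M N p) :
    willemsClosure (signalSpace n) M = (⨅ (i : Fin t) (_ : HasRationalPoint (p i)), N i) ∧
      (M = willemsClosure (signalSpace n) M ↔ ∀ i, HasRationalPoint (p i)) := by
  have h : willemsClosure (signalSpace n) M =
      ⨅ (i : Fin t) (_ : HasRationalPoint (p i)), N i := by
    refine le_antisymm (le_iInf₂ fun i hi => ?_) ?_
    · refine (willemsClosure_mono ?_).trans (willemsClosure_le_of_isPrimaryTo (hM.primary i) hi)
      exact hM.eq_iInf.trans_le (iInf_le _ i)
    · rw [hM.eq_iInf]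
      exact iInf_hasRationalPoint_le_willemsClosure hM.primary
  refine ⟨h, fun hc i => ?_, fun hr => ?_⟩
  · by_contra hi
    -- Without a rational point for `p i`, the formula for the closure does not involve `N i`, so
    -- `M` would be the intersection of the other components.
    refine hM.irredundant i (le_antisymm ?_ ?_)
    · exact le_iInf₂ fun j _ => hM.eq_iInf.trans_le (iInf_le _ j)
    · rw [hc.trans h]
      exact le_iInf₂ fun j hj => iInf₂_le j (by rintro rfl; exact hi hj)
  · rw [h, hM.eq_iInf]
    simp [hr]
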